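/- Let $n,k\ge 0$ and $T\ge 1$ be integers, let $A_0,\dots,A_{T-1}\in\mathbb R_{\ge 0}^{n\times n}$ be row-stochastic, let $\pi_1,\dots,\pi_k\in\{1,\dots,n\}$ be distinct, let $C\in\{0,1\}^{k\times n}$ be the matrix whose $a$-th row is the standard basis vector $e_{\pi_a}^\top$, and let $\rho_0,\dots,\rho_T\in\mathbb R^k$. For nonnegative matrices $P,Q$ with $\operatorname{supp}P\subseteq\operatorname{supp}Q$ put $$\mathcal D(P\,|\,Q)=\sum_{i,j}\Big(P_{ij}\log\frac{P_{ij}}{Q_{ij}}-P_{ij}+Q_{ij}\Big),\qquad 0\log 0:=0 .$$ Let $\mathcal M$ be the set of all $M=(M_0,\dots,M_{T-1})$ with $M_t\in\mathbb R^{n\times n}_{\ge0}$ and $\operatorname{supp}M_t\subseteq\operatorname{supp}(\operatorname{diag}(M_t\mathbf 1)A_t)$ for all $t$. The partially observed Schrödinger bridge problem (the primal problem) is $$\min_{M\in\mathcal M}\ \sum_{t=0}^{T-1}\mathcal D\big(M_t\,|\,\operatorname{diag}(M_t\mathbf 1)A_t\big)$$ subject to $CM_t\mathbf 1=\rho_t$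 for $0\le t\le T-1$, $CM_{T-1}^\top\mathbf 1=\rho_T$, and $M_t\mathbf 1=M_{t-1}^\top\mathbf 1$ for $1\le t\le T-1$. Its Lagrangian, for $\lambda_0,\dots,\lambda_T\in\mathbb R^k$ and $\nu_1,\dots,\nu_{T-1}\in\mathbb R^n$, is $$\mathcal L(M,\lambda,\nu)=\sum_{t=0}^{T-1}\mathcal D\big(M_t\,|\,\operatorname{diag}(M_t\mathbf 1)A_t\big)+\sum_{t=0}^{T-1}\lambda_t^\top(\rho_t-CM_t\mathbf 1)+\lambda_T^\top(\rho_T-CM_{T-1}^\top\mathbf 1)+\sum_{t=1}^{T-1}\nu_t^\top(M_t\mathbf 1-M_{t-1}^\top\mathbf 1),$$ and its dual function is $g(\lambda,\nu)=\inf_{M\in\mathcal M}\mathcal L(M,\lambda,\nu)\in[-\infty,\infty)$. **Theorem.** Assume that there is a feasible $M$ of the primal problem with $(M_t)_{ij}>0$ whenever $(A_t)_{ij}>0$. Then a dual formulation of the primal problem is $$\max_{\lambda_0,\dots,\lambda_T\in\mathbb R^k}\ \sum_{t=0}^{T}\lambda_t^\top\rho_t\quad\text{subject to}\quad \operatorname{diag}(u_0)A_0\operatorname{diag}(u_1)A_1\cdots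 \operatorname{diag}(u_{T-1})A_{T-1}u_T\le\mathbf 1,\qquad(\ast)$$ where $u_t:=\exp(C^\top\lambda_t)$ entrywise; that is, for every $\lambda$, $\sup_\nu g(\lambda,\nu)$ equals $\sum_t\lambda_t^\top\rho_t$ if $\lambda$ satisfies the constraint in $(\ast)$, and equals $-\infty$ otherwise, and there is no duality gap: the maximum in $(\ast)$ equals the infimum of the primal problem. The maximum in $(\ast)$ is attained. Moreover, for every maximizer $\lambda$ of $(\ast)$ there exist vectors $w_0,\dots,w_T\in\mathbb R^n_{>0}$ with $w_0=\mathbf 1$ and $w_T=u_T$ such that every primal optimal solution $M^*$ satisfies, for all $t=0,\dots,T-1$, $$M_t^*=\operatorname{diag}(M_t^*\mathbf 1)\,\operatorname{diag}(u_t\oslash w_t)\,A_t\,\operatorname{diag}(w_{t+1}),$$ where $\oslash$ is entrywise division. -/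

import Mathlib

open scoped Matrix

noncomputable section

namespace PartialSB

/-- A matrix with non-negative entries whose rows sum to one. -/
def RowStochastic {n : ℕ} (A : Matrix (Fin n) (Fin n) ℝ) : Prop :=
  (∀ i j, 0 ≤ A i j) ∧ A *ᵥ 1 = 1

/-- The observation matrix `C`: its rows are the standard basis vectors `e_{π a}` of the `k`
distinct observed states `π 0, …, π (k - 1)`. -/
def obsMatrix {n k : ℕ} (π : Fin k ↪ Fin n) : Matrix (Fin k) (Fin n) ℝ :=
  Matrix.of fun a => Pi.single (π a) 1

/-- `supp P ⊆ supp Q`. -/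
def SuppSubset {n : ℕ} (P Q : Matrix (Fin n) (Fin n) ℝ) : Prop :=
  ∀ i j, Q i j = 0 → P i j = 0

/-- The normalized Kullback-Leibler divergence of non-negative matrices. It is used only for
`supp P ⊆ supp Q`, where the conventions `x / 0 = 0` and `log 0 = 0` give `0 log 0 = 0`. -/
def kl {n : ℕ} (P Q : Matrix (Fin n) (Fin n) ℝ) : ℝ :=
  ∑ i, ∑ j, (P i j * Real.log (P i j / Q i j) - P i j + Q i j)

/-! The horizon is `T = N + 1`. Quantities at times `0, …, T - 1` are indexed by `Fin (N + 1)`,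
quantities at times `0, …, T` by `Fin (N + 2)`, and quantities at the interior times
`1, …, T - 1` by `Fin N`, where `s : Fin N` stands for the time `s + 1`. -/

variable {n k N : ℕ}

/-- The prior `diag(M_t 1) A_t`. -/
def prior (A M : Matrix (Fin n) (Fin n) ℝ) : Matrix (Fin n) (Fin n) ℝ :=
  Matrix.diagonal (M *ᵥ 1) * A

/-- The domain of the primal objective: `M_t` is entrywise non-negative and every divergence
`D(M_t | diag(M_t 1) A_t)` is defined. -/
def Admissible (A M : Fin (N + 1) → Matrix (Fin n) (Fin n) ℝ) : Prop :=
  ∀ t, (∀ i j, 0 ≤ M t i j) ∧ SuppSubset (M t) (prior (A t) (M t))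

/-- The primal objective `∑_t D(M_t | diag(M_t 1) A_t)`. -/
def primalObjective (A M : Fin (N + 1) → Matrix (Fin n) (Fin n) ℝ) : ℝ :=
  ∑ t, kl (M t) (prior (A t) (M t))

/-- Feasibility in the partially observed Schrödinger bridge problem. -/
structure PrimalFeasible (A : Fin (N + 1) → Matrix (Fin n) (Fin n) ℝ)
    (C : Matrix (Fin k) (Fin n) ℝ) (ρ : Fin (N + 2) → Fin k → ℝ)
    (M : Fin (N + 1) → Matrix (Fin n) (Fin n) ℝ) : Prop where
  admissible : Admissible A M
  observed : ∀ t : Fin (N + 1), C *ᵥ (M t *ᵥ 1) = ρ t.castSucc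
  observed_final : C *ᵥ ((M (Fin.last N))ᵀ *ᵥ 1) = ρ (Fin.last (N + 1))
  matching : ∀ s : Fin N, M s.succ *ᵥ 1 = (M s.castSucc)ᵀ *ᵥ 1

/-- Primal optimality. -/
def IsPrimalOptimal (A : Fin (N + 1) → Matrix (Fin n) (Fin n) ℝ)
    (C : Matrix (Fin k) (Fin n) ℝ) (ρ : Fin (N + 2) → Fin k → ℝ)
    (M : Fin (N + 1) → Matrix (Fin n) (Fin n) ℝ) : Prop :=
  PrimalFeasible A C ρ M ∧
    ∀ M', PrimalFeasible A C ρ M' → primalObjective A M ≤ primalObjective A M'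

/-- The regularity assumption: some feasible `M` is positive wherever `A` is. -/
def Regular (A : Fin (N + 1) → Matrix (Fin n) (Fin n) ℝ)
    (C : Matrix (Fin k) (Fin n) ℝ) (ρ : Fin (N + 2) → Fin k → ℝ) : Prop :=
  ∃ M, PrimalFeasible A C ρ M ∧ ∀ t i j, 0 < A t i j → 0 < M t i j

/-- The Lagrangian, with multipliers `lam` of the observation constraints and `ν` of the matching
constraints. -/
def lagrangian (A : Fin (N + 1) → Matrix (Fin n) (Fin n) ℝ)
    (C : Matrix (Fin k) (Fin n) ℝ) (ρ : Fin (N + 2) → Fin k → ℝ)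
    (M : Fin (N + 1) → Matrix (Fin n) (Fin n) ℝ)
    (lam : Fin (N + 2) → Fin k → ℝ) (ν : Fin N → Fin n → ℝ) : ℝ :=
  primalObjective A M
    + ∑ t : Fin (N + 1), lam t.castSucc ⬝ᵥ (ρ t.castSucc - C *ᵥ (M t *ᵥ 1))
    + lam (Fin.last (N + 1)) ⬝ᵥ
        (ρ (Fin.last (N + 1)) - C *ᵥ ((M (Fin.last N))ᵀ *ᵥ 1))
    + ∑ s : Fin N, ν s ⬝ᵥ (M s.succ *ᵥ 1 - (M s.castSucc)ᵀ *ᵥ 1)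

/-- The Lagrangian dual function: the infimum of the Lagrangian over the domain of the primal
objective, with value `⊥ = -∞` if the Lagrangian is unbounded below. -/
def dualFunction (A : Fin (N + 1) → Matrix (Fin n) (Fin n) ℝ)
    (C : Matrix (Fin k) (Fin n) ℝ) (ρ : Fin (N + 2) → Fin k → ℝ)
    (lam : Fin (N + 2) → Fin k → ℝ) (ν : Fin N → Fin n → ℝ) : EReal :=
  ⨅ (M : Fin (N + 1) → Matrix (Fin n) (Fin n) ℝ) (_ : Admissible A M),
    (lagrangian A C ρ M lam ν : EReal)

/-- The scaling vectors `u_t = exp(Cᵀ λ_t)`. -/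
def scaling (C : Matrix (Fin k) (Fin n) ℝ) (lam : Fin (N + 2) → Fin k → ℝ)
    (t : Fin (N + 2)) : Fin n → ℝ :=
  fun i => Real.exp ((Cᵀ *ᵥ lam t) i)

/-- The dual objective `∑_t λ_tᵀ ρ_t`. -/
def dualObjective (ρ lam : Fin (N + 2) → Fin k → ℝ) : ℝ :=
  ∑ t, lam t ⬝ᵥ ρ t

/-- The dual constraint `diag(u_0) A_0 diag(u_1) A_1 ⋯ diag(u_{T-1}) A_{T-1} u_T ≤ 1`. -/
def DualFeasible (A : Fin (N + 1) → Matrix (Fin n) (Fin n) ℝ)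
    (C : Matrix (Fin k) (Fin n) ℝ) (lam : Fin (N + 2) → Fin k → ℝ) : Prop :=
  (List.ofFn fun t : Fin (N + 1) => Matrix.diagonal (scaling C lam t.castSucc) * A t).prod
    *ᵥ scaling C lam (Fin.last (N + 1)) ≤ 1

/-- Maximizers of the dual problem. -/
def IsDualMaximizer (A : Fin (N + 1) → Matrix (Fin n) (Fin n) ℝ)
    (C : Matrix (Fin k) (Fin n) ℝ) (ρ : Fin (N + 2) → Fin k → ℝ)
    (lam : Fin (N + 2) → Fin k → ℝ) : Prop :=
  DualFeasible A C lam ∧ ∀ lam', DualFeasible A C lam' → dualObjective ρ lam' ≤ dualObjective ρ lam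

end PartialSB

end

/-! Let `w_t` be the exponential of the multiplier at time `t`: `w_0 = 1`, `w_T = u_T`, and `ν`
gives the interior times. Summing by parts in time, the constraint terms of the Lagrangian become
linear in `M` with coefficients `log (u_t(i) w_{t+1}(j) / w_t(i))`, and the divergence absorbs them
by tilting its reference. Thus (`lagrangian_eq_sum`) the Lagrangian is `∑ λ_t ⬝ ρ_t` plus, for each
row, a divergence from the tilted prior and the row mass times one minus the tilted row sum of
`A_t`. The dual function is therefore `∑ λ_t ⬝ ρ_t` if all tilted row sums are at most one;
otherwise enlarging one bad row drives it to `-∞`. Backward induction shows that suitable `w` exist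
exactly under `(∗)`, the partial products (`potential`) being one choice.

Attainment: a feasible flow positive on the support of `A` confines the tilts with nonnegative dual
value to a compact set (`exists_isDualMaximizer`).

Strong duality: at a maximizer, Gordan's alternative gives KKT weights `m` on the active rows of
`(∗)`. The reweighted Markov chain started from `m` is primal feasible and has value `∑ λ_t ⬝ ρ_t`.
For any primal optimum the row divergences must then all vanish, which is the scaling form. -/

noncomputable section

namespace PartialSB

variable {n k N : ℕ}

/-! ### Entrywise divergence and row sums -/

/-- The entrywise Kullback-Leibler divergence. -/
def klTerm (x y : ℝ) : ℝ := x * Real.log (x / y) - x + y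

lemma klTerm_zero_left (y : ℝ) : klTerm 0 y = y := by simp [klTerm]

lemma klTerm_self (x : ℝ) : klTerm x x = 0 := by
  by_cases hx : x = 0 <;> simp [klTerm, hx]

lemma klTerm_eq_mul_klFun {x y : ℝ} (hy : y ≠ 0) :
    klTerm x y = y * InformationTheory.klFun (x / y) := by
  unfold klTerm InformationTheory.klFun
  field_simp
  ring

lemma klTerm_nonneg {x y : ℝ} (hx : 0 ≤ x) (hy : 0 ≤ y) (hxy : y = 0 → x = 0) :
    0 ≤ klTerm x y := by
  by_cases h : y = 0
  · simp [hxy h, h, klTerm_self]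
  · rw [klTerm_eq_mul_klFun h]
    exact mul_nonneg hy (InformationTheory.klFun_nonneg (div_nonneg hx hy))

lemma eq_of_klTerm_eq_zero {x y : ℝ} (hx : 0 ≤ x) (hy : 0 ≤ y) (hxy : y = 0 → x = 0)
    (h0 : klTerm x y = 0) : x = y := by
  by_cases h : y = 0
  · rw [hxy h, h]
  · rw [klTerm_eq_mul_klFun h, mul_eq_zero, or_iff_right h,
      InformationTheory.klFun_eq_zero_iff (div_nonneg hx hy), div_eq_one_iff_eq h] at h0
    exact h0

/-- Exponential tilting: a term linear in the first argument is absorbed by multiplying the second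
by `exp z`, at the price of the change in its mass. -/
lemma klTerm_sub_mul {x y : ℝ} (z : ℝ) (hxy : y = 0 → x = 0) :
    klTerm x y - x * z = klTerm x (y * Real.exp z) + y - y * Real.exp z := by
  by_cases hx : x = 0
  · simp [hx, klTerm_zero_left]
  · have hy : y ≠ 0 := fun h => hx (hxy h)
    unfold klTerm
    rw [← div_div, Real.log_div (div_ne_zero hx hy) (Real.exp_ne_zero z), Real.log_exp]
    ring

lemma mulVec_one_apply (M : Matrix (Fin n) (Fin n) ℝ) (i : Fin n) :
    (M *ᵥ 1) i = ∑ j, M i j := by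
  simp [Matrix.mulVec, dotProduct]

lemma transpose_mulVec_one_apply (M : Matrix (Fin n) (Fin n) ℝ) (j : Fin n) :
    (Mᵀ *ᵥ 1) j = ∑ i, M i j := by
  simp [Matrix.mulVec, dotProduct]

lemma RowStochastic.sum_eq_one {A : Matrix (Fin n) (Fin n) ℝ} (hA : RowStochastic A) (i : Fin n) :
    ∑ j, A i j = 1 := by
  rw [← mulVec_one_apply, hA.2, Pi.one_apply]

lemma prior_apply (A M : Matrix (Fin n) (Fin n) ℝ) (i j : Fin n) :
    prior A M i j = (M *ᵥ 1) i * A i j := by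
  simp [prior, Matrix.diagonal_mul]

/-! ### The Lagrangian as a sum of tilted divergences -/

/-- The multipliers at all times `0, …, T`: zero at time `0`, `ν` at interior times, and `Cᵀ λ_T`
at time `T`. -/
def multiplier (C : Matrix (Fin k) (Fin n) ℝ) (lam : Fin (N + 2) → Fin k → ℝ)
    (ν : Fin N → Fin n → ℝ) : Fin (N + 2) → Fin n → ℝ :=
  Fin.cons (α := fun _ => Fin n → ℝ) 0
    (Fin.snoc (α := fun _ => Fin n → ℝ) ν (Cᵀ *ᵥ lam (Fin.last (N + 1))))

section multiplier
variable (C : Matrix (Fin k) (Fin n) ℝ) (lam : Fin (N + 2) → Fin k → ℝ) (ν : Fin N → Fin n → ℝ)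

@[simp] lemma multiplier_zero : multiplier C lam ν 0 = 0 := rfl

@[simp] lemma multiplier_castSucc_zero : multiplier C lam ν (Fin.castSucc 0) = 0 := rfl

@[simp] lemma multiplier_succ_last :
    multiplier C lam ν (Fin.last N).succ = Cᵀ *ᵥ lam (Fin.last (N + 1)) := by
  simp only [multiplier, Fin.cons_succ, Fin.snoc_last]

@[simp] lemma multiplier_last :
    multiplier C lam ν (Fin.last (N + 1)) = Cᵀ *ᵥ lam (Fin.last (N + 1)) :=
  multiplier_succ_last C lam ν

@[simp] lemma multiplier_succ_castSucc (s : Fin N) :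
    multiplier C lam ν s.castSucc.succ = ν s := by
  simp only [multiplier, Fin.cons_succ, Fin.snoc_castSucc]

@[simp] lemma multiplier_castSucc_succ (s : Fin N) :
    multiplier C lam ν s.succ.castSucc = ν s :=
  multiplier_succ_castSucc C lam ν s

/-- The exponent by which the multipliers reweight the transition from `i` to `j` at time `t`. -/
def tilt (t : Fin (N + 1)) (i j : Fin n) : ℝ :=
  (Cᵀ *ᵥ lam t.castSucc) i + multiplier C lam ν t.succ j - multiplier C lam ν t.castSucc i

/-- Summation by parts in time: the incoming and outgoing multipliers pair up at interior times. The
boundary values of `multiplier` leave nothing at time `0` and the `λ_T` term at time `T`. -/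
lemma sum_mul_tilt (M : Fin (N + 1) → Matrix (Fin n) (Fin n) ℝ) :
    ∑ t, ∑ i, ∑ j, M t i j * tilt C lam ν t i j =
      ∑ t : Fin (N + 1), lam t.castSucc ⬝ᵥ (C *ᵥ (M t *ᵥ 1))
        + lam (Fin.last (N + 1)) ⬝ᵥ (C *ᵥ ((M (Fin.last N))ᵀ *ᵥ 1))
        - ∑ s : Fin N, ν s ⬝ᵥ (M s.succ *ᵥ 1 - (M s.castSucc)ᵀ *ᵥ 1) := by
  have h (t : Fin (N + 1)) : ∑ i, ∑ j, M t i j * tilt C lam ν t i j =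
      lam t.castSucc ⬝ᵥ (C *ᵥ (M t *ᵥ 1)) + multiplier C lam ν t.succ ⬝ᵥ ((M t)ᵀ *ᵥ 1)
        - multiplier C lam ν t.castSucc ⬝ᵥ (M t *ᵥ 1) := by
    have h1 : ∑ i, ∑ j, M t i j * multiplier C lam ν t.succ j =
        multiplier C lam ν t.succ ⬝ᵥ ((M t)ᵀ *ᵥ 1) := by
      rw [Finset.sum_comm]
      simp only [dotProduct, transpose_mulVec_one_apply, Finset.mul_sum, mul_comm]
    have h2 (f : Fin n → ℝ) : ∑ i, ∑ j, M t i j * f i = f ⬝ᵥ (M t *ᵥ 1) := by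
      simp only [dotProduct, mulVec_one_apply, Finset.mul_sum, mul_comm]
    rw [Matrix.dotProduct_mulVec, ← Matrix.mulVec_transpose, ← h1, ← h2, ← h2]
    simp only [tilt, mul_sub, mul_add, Finset.sum_add_distrib, Finset.sum_sub_distrib]
  simp only [h, Finset.sum_add_distrib, Finset.sum_sub_distrib]
  rw [Fin.sum_univ_castSucc (fun t => multiplier C lam ν t.succ ⬝ᵥ ((M t)ᵀ *ᵥ 1)),
    Fin.sum_univ_succ (fun t => multiplier C lam ν t.castSucc ⬝ᵥ (M t *ᵥ 1))]
  simp only [multiplier_succ_castSucc, multiplier_succ_last, multiplier_castSucc_zero,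
    multiplier_castSucc_succ, zero_dotProduct, dotProduct_sub, Finset.sum_sub_distrib]
  rw [Matrix.mulVec_transpose, ← Matrix.dotProduct_mulVec]
  ring

lemma lagrangian_eq_sub (A M : Fin (N + 1) → Matrix (Fin n) (Fin n) ℝ)
    (ρ : Fin (N + 2) → Fin k → ℝ) :
    lagrangian A C ρ M lam ν = primalObjective A M + dualObjective ρ lam
      - ∑ t, ∑ i, ∑ j, M t i j * tilt C lam ν t i j := by
  rw [sum_mul_tilt, lagrangian, dualObjective, Fin.sum_univ_castSucc (n := N + 1)]
  simp only [dotProduct_sub, Finset.sum_sub_distrib]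
  ring

lemma lagrangian_eq_sum {A M : Fin (N + 1) → Matrix (Fin n) (Fin n) ℝ}
    (hA : ∀ t, RowStochastic (A t)) (hM : Admissible A M) (ρ : Fin (N + 2) → Fin k → ℝ) :
    lagrangian A C ρ M lam ν = dualObjective ρ lam
      + ∑ t, ∑ i, ((∑ j, klTerm (M t i j)
          ((M t *ᵥ 1) i * A t i j * Real.exp (tilt C lam ν t i j)))
        + (M t *ᵥ 1) i * (1 - ∑ j, A t i j * Real.exp (tilt C lam ν t i j))) := by
  rw [lagrangian_eq_sub, primalObjective]
  have h : ∑ t, kl (M t) (prior (A t) (M t)) - ∑ t, ∑ i, ∑ j, M t i j * tilt C lam ν t i j =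
      ∑ t, ∑ i, ((∑ j, klTerm (M t i j)
          ((M t *ᵥ 1) i * A t i j * Real.exp (tilt C lam ν t i j)))
        + (M t *ᵥ 1) i * (1 - ∑ j, A t i j * Real.exp (tilt C lam ν t i j))) := by
    rw [← Finset.sum_sub_distrib]
    refine Finset.sum_congr rfl fun t _ => ?_
    rw [kl, ← Finset.sum_sub_distrib]
    refine Finset.sum_congr rfl fun i _ => ?_
    rw [← (hA t).sum_eq_one i, ← Finset.sum_sub_distrib, ← Finset.sum_sub_distrib,
      Finset.mul_sum, ← Finset.sum_add_distrib]
    refine Finset.sum_congr rfl fun j _ => ?_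
    have := klTerm_sub_mul (tilt C lam ν t i j) ((hM t).2 i j)
    rw [prior_apply] at this ⊢
    rw [klTerm] at this
    linarith
  linarith

lemma PrimalFeasible.lagrangian_eq {A M : Fin (N + 1) → Matrix (Fin n) (Fin n) ℝ}
    {C : Matrix (Fin k) (Fin n) ℝ} {ρ : Fin (N + 2) → Fin k → ℝ}
    (hM : PrimalFeasible A C ρ M) (lam : Fin (N + 2) → Fin k → ℝ) (ν : Fin N → Fin n → ℝ) :
    lagrangian A C ρ M lam ν = primalObjective A M := by
  simp [lagrangian, hM.observed, hM.observed_final, hM.matching]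

lemma PrimalFeasible.dualObjective_eq {A M : Fin (N + 1) → Matrix (Fin n) (Fin n) ℝ}
    {C : Matrix (Fin k) (Fin n) ℝ} {ρ : Fin (N + 2) → Fin k → ℝ}
    (hM : PrimalFeasible A C ρ M) (lam : Fin (N + 2) → Fin k → ℝ) (ν : Fin N → Fin n → ℝ) :
    dualObjective ρ lam = ∑ t, ∑ i, ∑ j, M t i j * tilt C lam ν t i j := by
  have h1 := hM.lagrangian_eq lam ν
  rw [lagrangian_eq_sub] at h1
  linarith

end multiplier

/-! ### The dual function for fixed multipliers -/

/-- The multipliers make every reweighted transition matrix substochastic. -/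
def Substochastic (A : Fin (N + 1) → Matrix (Fin n) (Fin n) ℝ) (C : Matrix (Fin k) (Fin n) ℝ)
    (lam : Fin (N + 2) → Fin k → ℝ) (ν : Fin N → Fin n → ℝ) : Prop :=
  ∀ t i, ∑ j, A t i j * Real.exp (tilt C lam ν t i j) ≤ 1

section dual
variable {A M : Fin (N + 1) → Matrix (Fin n) (Fin n) ℝ} {C : Matrix (Fin k) (Fin n) ℝ}
  {ρ lam : Fin (N + 2) → Fin k → ℝ} {ν : Fin N → Fin n → ℝ}

lemma mulVec_one_nonneg {M : Matrix (Fin n) (Fin n) ℝ} (hM : ∀ i j, 0 ≤ M i j) (i : Fin n) :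
    0 ≤ (M *ᵥ 1) i := by
  rw [mulVec_one_apply]
  exact Finset.sum_nonneg fun j _ => hM i j

lemma Admissible.weight_nonneg (hA : ∀ t, RowStochastic (A t)) (hM : Admissible A M)
    (t i j) (z : ℝ) : 0 ≤ (M t *ᵥ 1) i * A t i j * Real.exp z :=
  mul_nonneg (mul_nonneg (mulVec_one_nonneg (hM t).1 i) ((hA t).1 i j)) (Real.exp_pos z).le

lemma Admissible.eq_zero_of_weight (hM : Admissible A M) (t i j) (z : ℝ)
    (h : (M t *ᵥ 1) i * A t i j * Real.exp z = 0) : M t i j = 0 := by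
  refine (hM t).2 i j ?_
  rw [prior_apply]
  exact (mul_eq_zero.1 h).resolve_right (Real.exp_ne_zero z)

lemma Admissible.klTerm_nonneg (hA : ∀ t, RowStochastic (A t)) (hM : Admissible A M)
    (t i j) (z : ℝ) : 0 ≤ klTerm (M t i j) ((M t *ᵥ 1) i * A t i j * Real.exp z) :=
  PartialSB.klTerm_nonneg ((hM t).1 i j) (hM.weight_nonneg hA t i j z)
    (hM.eq_zero_of_weight t i j z)

lemma Substochastic.gap_nonneg (hν : Substochastic A C lam ν) (hA : ∀ t, RowStochastic (A t))
    (hM : Admissible A M) (t i) :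
    0 ≤ (∑ j, klTerm (M t i j) ((M t *ᵥ 1) i * A t i j * Real.exp (tilt C lam ν t i j)))
        + (M t *ᵥ 1) i * (1 - ∑ j, A t i j * Real.exp (tilt C lam ν t i j)) :=
  add_nonneg (Finset.sum_nonneg fun j _ => hM.klTerm_nonneg hA t i j _)
    (mul_nonneg (mulVec_one_nonneg (hM t).1 i) (sub_nonneg.2 (hν t i)))

lemma Substochastic.le_lagrangian (hν : Substochastic A C lam ν)
    (hA : ∀ t, RowStochastic (A t)) (hM : Admissible A M) :
    dualObjective ρ lam ≤ lagrangian A C ρ M lam ν := by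
  rw [lagrangian_eq_sum C lam ν hA hM]
  exact le_add_of_nonneg_right (Finset.sum_nonneg fun t _ =>
    Finset.sum_nonneg fun i _ => hν.gap_nonneg hA hM t i)

lemma Substochastic.eq_of_lagrangian_eq (hν : Substochastic A C lam ν)
    (hA : ∀ t, RowStochastic (A t)) (hM : Admissible A M)
    (h : lagrangian A C ρ M lam ν = dualObjective ρ lam) (t i j) :
    M t i j = (M t *ᵥ 1) i * A t i j * Real.exp (tilt C lam ν t i j) := by
  rw [lagrangian_eq_sum C lam ν hA hM, add_eq_left, Finset.sum_eq_zero_iff_of_nonneg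
    fun t _ => Finset.sum_nonneg fun i _ => hν.gap_nonneg hA hM t i] at h
  have h1 := h t (Finset.mem_univ t)
  rw [Finset.sum_eq_zero_iff_of_nonneg fun i _ => hν.gap_nonneg hA hM t i] at h1
  have h2 := h1 i (Finset.mem_univ i)
  rw [add_eq_zero_iff_of_nonneg (Finset.sum_nonneg fun j _ => hM.klTerm_nonneg hA t i j _)
    (mul_nonneg (mulVec_one_nonneg (hM t).1 i) (sub_nonneg.2 (hν t i))),
    Finset.sum_eq_zero_iff_of_nonneg fun j _ => hM.klTerm_nonneg hA t i j _] at h2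
  exact eq_of_klTerm_eq_zero ((hM t).1 i j) (hM.weight_nonneg hA t i j _)
    (hM.eq_zero_of_weight t i j _) (h2.1 j (Finset.mem_univ j))

lemma admissible_zero : Admissible A (0 : Fin (N + 1) → Matrix (Fin n) (Fin n) ℝ) :=
  fun _ => ⟨fun _ _ => le_rfl, fun _ _ _ => rfl⟩

/-- The zero flow is admissible, so the dual function never exceeds the dual objective, whatever `ν`
is. -/
lemma lagrangian_zero : lagrangian A C ρ 0 lam ν = dualObjective ρ lam := by
  rw [lagrangian_eq_sub]
  simp [primalObjective, kl, prior]

lemma dualFunction_le : dualFunction A C ρ lam ν ≤ dualObjective ρ lam := by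
  rw [← lagrangian_zero (A := A) (C := C) (ν := ν)]
  exact iInf₂_le 0 admissible_zero

lemma Substochastic.dualFunction_eq (hν : Substochastic A C lam ν)
    (hA : ∀ t, RowStochastic (A t)) : dualFunction A C ρ lam ν = dualObjective ρ lam :=
  le_antisymm dualFunction_le
    (le_iInf₂ fun _ hM => EReal.coe_le_coe_iff.2 (hν.le_lagrangian hA hM))

/-- If the tilted weights of row `i` at time `t` have sum `G > 1`, put mass `c` on that row,
distributed in proportion to them, and zero elsewhere. The Lagrangian is then `dualObjective ρ lam -
c * log G`, unbounded below in `c`. -/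
lemma dualFunction_eq_bot (hA : ∀ t, RowStochastic (A t)) (hν : ¬ Substochastic A C lam ν) :
    dualFunction A C ρ lam ν = ⊥ := by
  simp only [Substochastic, not_forall, not_le] at hν
  obtain ⟨t, i, hG⟩ := hν
  set e : Fin n → ℝ := fun j => A t i j * Real.exp (tilt C lam ν t i j) with he
  set G := ∑ j, e j with hGdef
  have hG0 : 0 < G := one_pos.trans hG
  have hlog : 0 < Real.log G := Real.log_pos hG
  have he0 (j) : 0 ≤ e j := mul_nonneg ((hA t).1 i j) (Real.exp_pos _).le
  rw [EReal.eq_bot_iff_forall_lt]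
  intro y
  obtain ⟨c, hc0, hc⟩ : ∃ c : ℝ, 0 ≤ c ∧ dualObjective ρ lam - c * Real.log G < y := by
    obtain ⟨m, hm⟩ := exists_nat_gt ((dualObjective ρ lam - y) / Real.log G)
    exact ⟨m, m.cast_nonneg, by rw [div_lt_iff₀ hlog] at hm; linarith⟩
  set M : Fin (N + 1) → Matrix (Fin n) (Fin n) ℝ :=
    Pi.single t (Matrix.of (Pi.single i fun j => c * (e j / G))) with hMdef
  have hMt : M t i = fun j => c * (e j / G) := by ext j; simp [hMdef]
  have hM0 (t' i') (h : ¬ (t' = t ∧ i' = i)) : M t' i' = 0 := by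
    by_cases ht : t' = t
    · subst ht
      have : i' ≠ i := fun h' => h ⟨rfl, h'⟩
      ext j; simp [hMdef, this]
    · ext j; simp [hMdef, ht]
  have hr : (M t *ᵥ 1) i = c := by
    rw [mulVec_one_apply, hMt, ← Finset.mul_sum, ← Finset.sum_div, ← hGdef, div_self hG0.ne',
      mul_one]
  have hM : Admissible A M := by
    intro t'
    refine ⟨fun i' j => ?_, fun i' j h => ?_⟩ <;> by_cases hti : t' = t ∧ i' = i
    · obtain ⟨rfl, rfl⟩ := hti
      rw [hMt]
      exact mul_nonneg hc0 (div_nonneg (he0 j) hG0.le)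
    · simp [hM0 _ _ hti]
    · obtain ⟨rfl, rfl⟩ := hti
      rw [prior_apply, hr] at h
      rw [hMt]
      rcases mul_eq_zero.1 h with h | h <;> simp [he, h]
    · simp [hM0 _ _ hti]
  refine (iInf₂_le M hM).trans_lt (EReal.coe_lt_coe_iff.2 (lt_of_eq_of_lt ?_ hc))
  rw [lagrangian_eq_sum C lam ν hA hM, Finset.sum_eq_single t, Finset.sum_eq_single i, hr]
  · have h1 (j) : klTerm (M t i j) (c * A t i j * Real.exp (tilt C lam ν t i j)) =
        -(c * Real.log G / G) * e j - c / G * e j + c * e j := by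
      have : c * A t i j * Real.exp (tilt C lam ν t i j) = c * e j := by simp [he, mul_assoc]
      rw [this, hMt, klTerm]
      by_cases h0 : c * e j = 0
      · rcases mul_eq_zero.1 h0 with h | h <;> simp [h]
      · have : c * (e j / G) / (c * e j) = G⁻¹ := by
          have := left_ne_zero_of_mul h0
          have := right_ne_zero_of_mul h0
          field_simp
        rw [this, Real.log_inv]
        ring
    simp only [h1, Finset.sum_add_distrib, Finset.sum_sub_distrib, ← Finset.mul_sum]
    change dualObjective ρ lam + (-(c * Real.log G / G) * G - c / G * G + c * G
      + c * (1 - G)) = _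
    field_simp
    ring
  · intro i' _ hi'
    have := hM0 t i' (fun h => hi' h.2)
    simp [mulVec_one_apply, this, klTerm_self]
  · simp
  · intro t' _ ht'
    have this (i') : M t' i' = 0 := hM0 t' i' (fun h => ht' h.1)
    simp [mulVec_one_apply, this, klTerm_self]
  · simp

end dual

/-! ### Eliminating the matching multipliers -/

section potential
variable (A : Fin (N + 1) → Matrix (Fin n) (Fin n) ℝ) (C : Matrix (Fin k) (Fin n) ℝ)
  (lam : Fin (N + 2) → Fin k → ℝ)

/-- The backward potentials `diag(u_t) A_t ⋯ diag(u_{T-1}) A_{T-1} u_T`. -/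
def potential (t : Fin (N + 2)) : Fin n → ℝ :=
  ((List.ofFn fun s : Fin (N + 1) =>
    Matrix.diagonal (scaling C lam s.castSucc) * A s).drop t).prod
      *ᵥ scaling C lam (Fin.last (N + 1))

lemma potential_last : potential A C lam (Fin.last (N + 1)) = scaling C lam (Fin.last (N + 1)) := by
  rw [potential, List.drop_eq_nil_of_le (by simp), List.prod_nil, Matrix.one_mulVec]

lemma potential_castSucc (t : Fin (N + 1)) (i : Fin n) :
    potential A C lam t.castSucc i = Real.exp ((Cᵀ *ᵥ lam t.castSucc) i)
      * ∑ j, A t i j * potential A C lam t.succ j := by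
  have h : (t.castSucc : ℕ) < (List.ofFn fun s : Fin (N + 1) =>
    Matrix.diagonal (scaling C lam s.castSucc) * A s).length := by
      rw [List.length_ofFn]; exact t.isLt
  rw [potential, List.drop_eq_getElem_cons h, List.prod_cons, ← Matrix.mulVec_mulVec,
    List.getElem_ofFn, ← Matrix.mulVec_mulVec, Matrix.mulVec_diagonal]
  rfl

lemma dualFeasible_iff_potential_le : DualFeasible A C lam ↔ ∀ i, potential A C lam 0 i ≤ 1 :=
  Iff.rfl

variable {A}

lemma RowStochastic.sum_mul_pos {A : Matrix (Fin n) (Fin n) ℝ} (hA : RowStochastic A)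
    {f : Fin n → ℝ} (hf : ∀ j, 0 < f j) (i : Fin n) : 0 < ∑ j, A i j * f j := by
  obtain ⟨j, hj⟩ : ∃ j, A i j ≠ 0 := by
    by_contra! h
    simpa [h] using hA.sum_eq_one i
  exact Finset.sum_pos' (fun j _ => mul_nonneg (hA.1 i j) (hf j).le)
    ⟨j, Finset.mem_univ j, mul_pos ((hA.1 i j).lt_of_ne' hj) (hf j)⟩

lemma potential_pos (hA : ∀ t, RowStochastic (A t)) (t : Fin (N + 2)) :
    ∀ i, 0 < potential A C lam t i := by
  induction t using Fin.reverseInduction with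
  | last => intro i; rw [potential_last]; exact Real.exp_pos _
  | cast t ih =>
    intro i
    rw [potential_castSucc]
    exact mul_pos (Real.exp_pos _) ((hA t).sum_mul_pos ih i)

variable (A)

/-- The interior multipliers given by the logarithms of the potentials. -/
def logPotential (s : Fin N) (i : Fin n) : ℝ := Real.log (potential A C lam s.succ.castSucc i)

variable {A}

lemma exp_multiplier_succ (hA : ∀ t, RowStochastic (A t)) (t : Fin (N + 1)) (i : Fin n) :
    Real.exp (multiplier C lam (logPotential A C lam) t.succ i) = potential A C lam t.succ i := by
  induction t using Fin.lastCases with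
  | last => rw [multiplier_succ_last, Fin.succ_last, potential_last]; rfl
  | cast s =>
    rw [multiplier_succ_castSucc, logPotential, ← Fin.succ_castSucc,
      Real.exp_log (potential_pos C lam hA _ i)]

variable (ν : Fin N → Fin n → ℝ)

lemma exp_tilt (t : Fin (N + 1)) (i j : Fin n) : Real.exp (tilt C lam ν t i j) =
    scaling C lam t.castSucc i / Real.exp (multiplier C lam ν t.castSucc i)
      * Real.exp (multiplier C lam ν t.succ j) := by
  rw [tilt, Real.exp_sub, Real.exp_add, scaling]
  ring

lemma sum_mul_exp_tilt (hA : ∀ t, RowStochastic (A t)) (t : Fin (N + 1)) (i : Fin n) :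
    ∑ j, A t i j * Real.exp (tilt C lam (logPotential A C lam) t i j) =
      potential A C lam t.castSucc i
        / Real.exp (multiplier C lam (logPotential A C lam) t.castSucc i) := by
  simp only [exp_tilt, exp_multiplier_succ C lam hA]
  rw [potential_castSucc, Finset.mul_sum, Finset.sum_div]
  refine Finset.sum_congr rfl fun j _ => ?_
  rw [scaling]
  ring

variable {C lam ν}

/-- With `w_t` equal to the potential, the tilted rows at times `t ≥ 1` sum to exactly one. At time
`0`, where `w_0 = 1` is forced, the row sum is the potential itself, which `(∗)` bounds. -/
lemma DualFeasible.substochastic (h : DualFeasible A C lam) (hA : ∀ t, RowStochastic (A t)) :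
    Substochastic A C lam (logPotential A C lam) := by
  intro t i
  rw [sum_mul_exp_tilt C lam hA]
  induction t using Fin.cases with
  | zero =>
    simpa only [Fin.castSucc_zero, multiplier_zero, Pi.zero_apply, Real.exp_zero, div_one]
      using (dualFeasible_iff_potential_le A C lam).1 h i
  | succ s =>
    rw [← Fin.succ_castSucc, exp_multiplier_succ C lam hA,
      div_self (potential_pos C lam hA _ i).ne']

/-- Backward induction: substochasticity says that `w` is a supersolution of the recursion solved by
the potentials, with the same terminal value, so it dominates them; at time `0` it equals one. -/
lemma Substochastic.dualFeasible (hν : Substochastic A C lam ν)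
    (hA : ∀ t, RowStochastic (A t)) : DualFeasible A C lam := by
  have h (t : Fin (N + 2)) : ∀ i, potential A C lam t i ≤ Real.exp (multiplier C lam ν t i) := by
    induction t using Fin.reverseInduction with
    | last => intro i; rw [potential_last, multiplier_last]; rfl
    | cast t ih =>
      intro i
      have h1 := hν t i
      have h2 : ∑ j, A t i j * Real.exp (tilt C lam ν t i j) =
          Real.exp ((Cᵀ *ᵥ lam t.castSucc) i)
            * (∑ j, A t i j * Real.exp (multiplier C lam ν t.succ j))
            / Real.exp (multiplier C lam ν t.castSucc i) := by
        rw [Finset.mul_sum, Finset.sum_div]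
        refine Finset.sum_congr rfl fun j _ => ?_
        rw [exp_tilt, scaling]
        ring
      rw [h2, div_le_one (Real.exp_pos _)] at h1
      rw [potential_castSucc]
      refine le_trans ?_ h1
      gcongr with j
      · exact (hA t).1 i j
      · exact ih j
  rw [dualFeasible_iff_potential_le]
  intro i
  simpa only [multiplier_zero, Pi.zero_apply, Real.exp_zero] using h 0 i

end potential

/-! ### Attainment of the dual maximum -/

section attainment
variable {A M : Fin (N + 1) → Matrix (Fin n) (Fin n) ℝ} {C : Matrix (Fin k) (Fin n) ℝ}
  {ρ : Fin (N + 2) → Fin k → ℝ}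

lemma multiplier_add (lam lam' : Fin (N + 2) → Fin k → ℝ) (ν ν' : Fin N → Fin n → ℝ)
    (t : Fin (N + 2)) : multiplier C (lam + lam') (ν + ν') t =
      multiplier C lam ν t + multiplier C lam' ν' t := by
  induction t using Fin.cases with
  | zero => simp
  | succ t => induction t using Fin.lastCases <;> simp [Matrix.mulVec_add]

lemma multiplier_smul (c : ℝ) (lam : Fin (N + 2) → Fin k → ℝ) (ν : Fin N → Fin n → ℝ)
    (t : Fin (N + 2)) : multiplier C (c • lam) (c • ν) t = c • multiplier C lam ν t := by
  induction t using Fin.cases with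
  | zero => simp
  | succ t => induction t using Fin.lastCases <;> simp [Matrix.mulVec_smul]

variable (A C) in
/-- The exponents `tilt`, restricted to the support of the transition matrices, as a linear
function of the multipliers. -/
def tiltMap : ((Fin (N + 2) → Fin k → ℝ) × (Fin N → Fin n → ℝ)) →ₗ[ℝ]
    (Fin (N + 1) → Fin n → Fin n → ℝ) where
  toFun p t i j := if A t i j = 0 then 0 else tilt C p.1 p.2 t i j
  map_add' p q := by
    ext t i j
    simp only [Prod.fst_add, Prod.snd_add, Pi.add_apply, tilt, multiplier_add, Matrix.mulVec_add]
    split_ifs <;> ring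
  map_smul' c p := by
    ext t i j
    simp only [Prod.smul_fst, Prod.smul_snd, Pi.smul_apply, tilt, multiplier_smul,
      Matrix.mulVec_smul, smul_eq_mul, RingHom.id_apply]
    split_ifs <;> ring

lemma mul_exp_tiltMap (p : (Fin (N + 2) → Fin k → ℝ) × (Fin N → Fin n → ℝ)) (t i j) :
    A t i j * Real.exp (tiltMap A C p t i j) = A t i j * Real.exp (tilt C p.1 p.2 t i j) := by
  by_cases h : A t i j = 0 <;> simp [tiltMap, h]

lemma Admissible.eq_zero (hM : Admissible A M) {t i j} (h : A t i j = 0) : M t i j = 0 :=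
  (hM t).2 i j (by simp [prior_apply, h])

lemma PrimalFeasible.dualObjective_eq_tiltMap (hM : PrimalFeasible A C ρ M)
    (p : (Fin (N + 2) → Fin k → ℝ) × (Fin N → Fin n → ℝ)) :
    dualObjective ρ p.1 = ∑ t, ∑ i, ∑ j, M t i j * tiltMap A C p t i j := by
  rw [hM.dualObjective_eq p.1 p.2]
  refine Finset.sum_congr rfl fun t _ => Finset.sum_congr rfl fun i _ =>
    Finset.sum_congr rfl fun j _ => ?_
  by_cases h : A t i j = 0 <;> simp [tiltMap, h, hM.admissible.eq_zero]

/-- The dual maximum is attained. -/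
lemma exists_isDualMaximizer (hA : ∀ t, RowStochastic (A t)) (hreg : Regular A C ρ) :
    ∃ lam, IsDualMaximizer A C ρ lam := by
  obtain ⟨M, hM, hpos⟩ := hreg
  let obj : (Fin (N + 1) → Fin n → Fin n → ℝ) → ℝ := fun z => ∑ t, ∑ i, ∑ j, M t i j * z t i j
  -- Compactness may fail for the multipliers themselves, since `tiltMap` may have a kernel; the
  -- maximization is done in its range. The condition `0 ≤ obj z` keeps the tilts at least as good
  -- as zero multipliers.
  let K : Set (Fin (N + 1) → Fin n → Fin n → ℝ) := {z | z ∈ LinearMap.range (tiltMap A C) ∧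
    (∀ t i, ∑ j, A t i j * Real.exp (z t i j) ≤ 1) ∧ 0 ≤ obj z}
  let B : Fin (N + 1) → Fin n → Fin n → ℝ := fun t i j => -Real.log (A t i j)
  have hobj : Continuous obj := by fun_prop
  have hM0 (t i j) : 0 ≤ M t i j := (hM.admissible t).1 i j
  have hzero (z) (hz : z ∈ LinearMap.range (tiltMap A C)) (t i j) (h : A t i j = 0) :
      z t i j = 0 := by
    obtain ⟨p, rfl⟩ := hz
    simp [tiltMap, h]
  have hupper (z) (hz : z ∈ K) (t i j) : z t i j ≤ B t i j := by
    rcases ((hA t).1 i j).eq_or_lt' with h | h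
    · simp [B, h, hzero z hz.1 t i j h]
    · have h1 : A t i j * Real.exp (z t i j) ≤ 1 :=
        (Finset.single_le_sum (f := fun j => A t i j * Real.exp (z t i j))
          (fun j _ => mul_nonneg ((hA t).1 i j) (Real.exp_pos _).le)
          (Finset.mem_univ j)).trans (hz.2.1 t i)
      have h2 := Real.log_le_log (mul_pos h (Real.exp_pos _)) h1
      rw [Real.log_mul h.ne' (Real.exp_ne_zero _), Real.log_exp, Real.log_one] at h2
      simp only [B]
      linarith
  -- Each entry of `z` lies below `B`, and `obj` has positive weights on the support of `A`, so a
  -- very negative entry would make `obj z` negative. Off the support both `B` and `z` vanish,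
  -- because `Real.log 0 = 0`, and so does the quotient by `M t i j = 0`.
  have hlower (z) (hz : z ∈ K) (t i j) : B t i j - obj B / M t i j ≤ z t i j := by
    rcases ((hA t).1 i j).eq_or_lt' with h | h
    · simp [B, h, hzero z hz.1 t i j h, hM.admissible.eq_zero h]
    · have h0 (t i j) : 0 ≤ M t i j * (B t i j - z t i j) :=
        mul_nonneg (hM0 t i j) (sub_nonneg.2 (hupper z hz t i j))
      have h1 : M t i j * (B t i j - z t i j) ≤
          ∑ t, ∑ i, ∑ j, M t i j * (B t i j - z t i j) := by
        refine le_trans ?_ (Finset.single_le_sum (fun t _ => Finset.sum_nonneg fun i _ =>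
          Finset.sum_nonneg fun j _ => h0 t i j) (Finset.mem_univ t))
        refine le_trans ?_ (Finset.single_le_sum (fun i _ =>
          Finset.sum_nonneg fun j _ => h0 t i j) (Finset.mem_univ i))
        exact Finset.single_le_sum (f := fun j => M t i j * (B t i j - z t i j))
          (fun j _ => h0 t i j) (Finset.mem_univ j)
      have h2 : ∑ t, ∑ i, ∑ j, M t i j * (B t i j - z t i j) = obj B - obj z := by
        simp only [obj, mul_sub, Finset.sum_sub_distrib]
      have h3 : B t i j - z t i j ≤ obj B / M t i j := by
        rw [le_div_iff₀' (hpos t i j h)]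
        linarith [hz.2.2]
      linarith
  have hK : IsCompact K := by
    refine (isCompact_Icc (a := fun t i j => B t i j - obj B / M t i j)
      (b := B)).of_isClosed_subset ?_ fun z hz =>
        ⟨fun t i j => hlower z hz t i j, fun t i j => hupper z hz t i j⟩
    have hsub : IsClosed {z : Fin (N + 1) → Fin n → Fin n → ℝ |
        ∀ t i, ∑ j, A t i j * Real.exp (z t i j) ≤ 1} := by
      simp only [Set.ofPred_forall]
      exact isClosed_iInter fun t => isClosed_iInter fun i =>
        isClosed_le (by fun_prop) continuous_const
    exact (Submodule.closed_of_finiteDimensional _).inter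
      (hsub.inter (isClosed_le continuous_const hobj))
  have h0K : (0 : Fin (N + 1) → Fin n → Fin n → ℝ) ∈ K :=
    ⟨zero_mem _, fun t i => by simp [(hA t).sum_eq_one i], by simp [obj]⟩
  obtain ⟨z, ⟨⟨p, rfl⟩, hp, hp0⟩, hmax⟩ := hK.exists_isMaxOn ⟨0, h0K⟩ hobj.continuousOn
  refine ⟨p.1, Substochastic.dualFeasible (ν := p.2) (fun t i => ?_) hA, fun lam' h' => ?_⟩
  · simpa only [mul_exp_tiltMap] using hp t i
  · have hp' := hM.dualObjective_eq_tiltMap p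
    have hq' := hM.dualObjective_eq_tiltMap (lam', logPotential A C lam')
    -- A competitor with negative value lies outside `K`, but loses to the nonnegative maximum.
    rcases le_or_gt 0 (dualObjective ρ lam') with h | h
    · rw [hp', hq']
      refine hmax ⟨⟨_, rfl⟩, fun t i => ?_, by simpa only [obj, ← hq'] using h⟩
      simpa only [mul_exp_tiltMap] using h'.substochastic hA t i
    · rw [hp']
      exact h.le.trans hp0

end attainment

/-! ### A theorem of the alternative -/

/-- Gordan's theorem of the alternative. -/
lemma exists_nonneg_combination_eq_zero {ι E : Type*} [Fintype ι] [AddCommGroup E] [Module ℝ E]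
    (f : ι → E →ₗ[ℝ] ℝ) (h : ∀ d, ∃ i, 0 ≤ f i d) :
    ∃ c : ι → ℝ, 0 ≤ c ∧ c ≠ 0 ∧ ∀ d, ∑ i, c i * f i d = 0 := by
  classical
  -- The hypothesis says that the range of `f` misses the open negative orthant; the coefficients
  -- are those of a separating functional.
  let U : Set (ι → ℝ) := Set.univ.pi fun _ => Set.Iio 0
  have hU : IsOpen U := isOpen_set_pi Set.finite_univ fun _ _ => isOpen_Iio
  have hUc : Convex ℝ U := convex_pi fun _ _ => convex_Iio 0
  have hdisj : Disjoint U (LinearMap.range (LinearMap.pi f) : Set (ι → ℝ)) := by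
    rw [Set.disjoint_left]
    rintro _ hx ⟨d, rfl⟩
    obtain ⟨i, hi⟩ := h d
    exact (hx i (Set.mem_univ i)).not_ge hi
  obtain ⟨F, u, hF, hu⟩ :=
    geometric_hahn_banach_open hUc hU (LinearMap.range (LinearMap.pi f)).convex hdisj
  have hu0 : u ≤ 0 := by simpa using hu 0 (zero_mem _)
  have hsum (x : ι → ℝ) : F x = ∑ i, F (Pi.single i 1) * x i := by
    have := LinearMap.pi_apply_eq_sum_univ (F : (ι → ℝ) →ₗ[ℝ] ℝ) x
    simp only [ContinuousLinearMap.coe_coe, smul_eq_mul] at this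
    rw [this]
    refine Finset.sum_congr rfl fun i _ => ?_
    rw [mul_comm]
    congr 2
    ext j
    simp [Pi.single_apply, eq_comm]
  have hneg : F (-1) < 0 := (hF _ fun i _ => by simp).trans_le hu0
  refine ⟨fun i => F (Pi.single i 1), fun i => ?_, fun hc => ?_, fun d => ?_⟩
  · by_contra! hi
    simp only [Pi.zero_apply] at hi
    have hF1 : 0 < F 1 := by simpa using hneg
    -- Chosen so that `F` vanishes at `Pi.single i 1 + ε • 1`, whose negative lies in `U`, where `F`
    -- is negative.
    set ε := -F (Pi.single i 1) / F 1 with hε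
    have hε0 : 0 < ε := div_pos (neg_pos.2 hi) hF1
    have hmem : -(Pi.single i 1 + ε • 1 : ι → ℝ) ∈ U := by
      intro j _
      have : (0 : ℝ) ≤ (Pi.single i 1 : ι → ℝ) j := by
        rw [Pi.single_apply]; split_ifs <;> simp
      simp only [Pi.neg_apply, Pi.add_apply, Pi.smul_apply, Pi.one_apply, smul_eq_mul, mul_one,
        Set.mem_Iio]
      linarith
    have h1 := (hF _ hmem).trans_le hu0
    rw [map_neg, map_add, map_smul, smul_eq_mul, hε, div_mul_cancel₀ _ hF1.ne'] at h1
    simp at h1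
  · rw [hsum] at hneg
    simp [fun i => congrFun hc i] at hneg
  · have hd (s : ℝ) : u ≤ s * F (fun i => f i d) := by
      have := hu _ (⟨s • d, rfl⟩ : LinearMap.pi f (s • d) ∈ LinearMap.range (LinearMap.pi f))
      rwa [map_smul, map_smul, smul_eq_mul] at this
    rw [← hsum fun i => f i d]
    by_contra h0
    -- A functional bounded below on a subspace vanishes there: this scaling would give `u ≤ u - 1`.
    have := hd ((u - 1) / F fun i => f i d)
    rw [div_mul_cancel₀ _ h0] at this
    linarith

/-! ### Derivatives of the potentials -/

section gradient
variable (A : Fin (N + 1) → Matrix (Fin n) (Fin n) ℝ) (C : Matrix (Fin k) (Fin n) ℝ)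
  (lam : Fin (N + 2) → Fin k → ℝ)

/-- The transition matrices reweighted by the scaling vectors and the potentials. -/
def transition (t : Fin (N + 1)) (i j : Fin n) : ℝ :=
  Real.exp ((Cᵀ *ᵥ lam t.castSucc) i) * A t i j * potential A C lam t.succ j
    / potential A C lam t.castSucc i

/-- The exponent of the scaling vectors as a linear function of the multipliers. -/
def logScaling (t : Fin (N + 2)) (i : Fin n) : (Fin (N + 2) → Fin k → ℝ) →ₗ[ℝ] ℝ :=
  LinearMap.proj i ∘ₗ Cᵀ.mulVecLin ∘ₗ LinearMap.proj t

@[simp] lemma logScaling_apply (t : Fin (N + 2)) (i : Fin n) (d : Fin (N + 2) → Fin k → ℝ) :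
    logScaling C t i d = (Cᵀ *ᵥ d t) i := rfl

/-- The derivatives of the logarithms of the potentials. -/
def logGradient : Fin (N + 2) → Fin n → (Fin (N + 2) → Fin k → ℝ) →ₗ[ℝ] ℝ :=
  Fin.reverseInduction (motive := fun _ => Fin n → (Fin (N + 2) → Fin k → ℝ) →ₗ[ℝ] ℝ)
    (logScaling C (Fin.last (N + 1)))
    fun t δ i => logScaling C t.castSucc i + ∑ j, transition A C lam t i j • δ j

lemma logGradient_last (i : Fin n) (d : Fin (N + 2) → Fin k → ℝ) :
    logGradient A C lam (Fin.last (N + 1)) i d = (Cᵀ *ᵥ d (Fin.last (N + 1))) i := by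
  simp [logGradient]

lemma logGradient_castSucc (t : Fin (N + 1)) (i : Fin n) (d : Fin (N + 2) → Fin k → ℝ) :
    logGradient A C lam t.castSucc i d =
      (Cᵀ *ᵥ d t.castSucc) i + ∑ j, transition A C lam t i j * logGradient A C lam t.succ j d := by
  simp [logGradient]

variable {A}

lemma transition_nonneg (hA : ∀ t, RowStochastic (A t)) (t i j) : 0 ≤ transition A C lam t i j :=
  div_nonneg (mul_nonneg (mul_nonneg (Real.exp_pos _).le ((hA t).1 i j))
    (potential_pos C lam hA _ j).le) (potential_pos C lam hA _ i).le

lemma transition_pos (hA : ∀ t, RowStochastic (A t)) {t i j} (h : 0 < A t i j) :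
    0 < transition A C lam t i j :=
  div_pos (mul_pos (mul_pos (Real.exp_pos _) h) (potential_pos C lam hA _ j))
    (potential_pos C lam hA _ i)

lemma sum_transition (hA : ∀ t, RowStochastic (A t)) (t i) :
    ∑ j, transition A C lam t i j = 1 := by
  simp only [transition]
  rw [← Finset.sum_div, div_eq_one_iff_eq (potential_pos C lam hA _ i).ne', potential_castSucc,
    Finset.mul_sum]
  simp only [mul_assoc]

/-- Differentiating the backward recursion and dividing by the potential turns its weights into
`transition`, so the logarithmic derivatives satisfy the recursion of `logGradient`. -/
lemma hasDerivAt_potential (hA : ∀ t, RowStochastic (A t)) (d : Fin (N + 2) → Fin k → ℝ)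
    (t : Fin (N + 2)) : ∀ i, HasDerivAt (fun s : ℝ => potential A C (lam + s • d) t i)
      (potential A C lam t i * logGradient A C lam t i d) 0 := by
  have hexp (t : Fin (N + 2)) (i : Fin n) :
      HasDerivAt (fun s : ℝ => Real.exp ((Cᵀ *ᵥ (lam + s • d) t) i))
        (Real.exp ((Cᵀ *ᵥ lam t) i) * (Cᵀ *ᵥ d t) i) 0 := by
    have h1 : HasDerivAt (fun s : ℝ => (Cᵀ *ᵥ lam t) i + s * (Cᵀ *ᵥ d t) i)
        ((Cᵀ *ᵥ d t) i) 0 := by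
      simpa using ((hasDerivAt_id (0 : ℝ)).mul_const ((Cᵀ *ᵥ d t) i)).const_add
        ((Cᵀ *ᵥ lam t) i)
    simpa [Matrix.mulVec_add, Matrix.mulVec_smul] using h1.exp
  induction t using Fin.reverseInduction with
  | last =>
    intro i
    simpa only [potential_last, logGradient_last, scaling] using hexp (Fin.last (N + 1)) i
  | cast t ih =>
    intro i
    simp only [potential_castSucc]
    refine ((hexp t.castSucc i).fun_mul (HasDerivAt.fun_sum fun j (_ : j ∈ Finset.univ) =>
      (ih j).const_mul (A t i j))).congr_deriv ?_
    simp only [zero_smul, add_zero]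
    have h1 : ∑ j, A t i j * (potential A C lam t.succ j * logGradient A C lam t.succ j d) =
        potential A C lam t.castSucc i * Real.exp (-(Cᵀ *ᵥ lam t.castSucc) i) *
          ∑ j, transition A C lam t i j * logGradient A C lam t.succ j d := by
      rw [Finset.mul_sum]
      refine Finset.sum_congr rfl fun j _ => ?_
      have := (potential_pos C lam hA t.castSucc i).ne'
      have := Real.exp_ne_zero ((Cᵀ *ᵥ lam t.castSucc) i)
      rw [transition, Real.exp_neg]
      field_simp
    rw [h1, logGradient_castSucc, potential_castSucc, Real.exp_neg]
    have := Real.exp_ne_zero ((Cᵀ *ᵥ lam t.castSucc) i)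
    field_simp

variable {C}

lemma transpose_mulVec_one_nonneg (hC : ∀ a i, 0 ≤ C a i) (i : Fin n) : 0 ≤ (Cᵀ *ᵥ 1) i := by
  simpa [Matrix.mulVec, dotProduct] using Finset.sum_nonneg fun a _ => hC a i

lemma transpose_mulVec_eq_zero (hC : ∀ a i, 0 ≤ C a i) {i : Fin n} (h : (Cᵀ *ᵥ 1) i = 0)
    (x : Fin k → ℝ) : (Cᵀ *ᵥ x) i = 0 := by
  have h' : ∑ a, C a i = 0 := by simpa [Matrix.mulVec, dotProduct] using h
  rw [Finset.sum_eq_zero_iff_of_nonneg fun a _ => hC a i] at h'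
  simp [Matrix.mulVec, dotProduct, h']

lemma logGradient_one_nonneg (hA : ∀ t, RowStochastic (A t)) (hC : ∀ a i, 0 ≤ C a i)
    (t : Fin (N + 2)) : ∀ i, 0 ≤ logGradient A C lam t i 1 := by
  induction t using Fin.reverseInduction with
  | last => intro i; rw [logGradient_last]; exact transpose_mulVec_one_nonneg hC i
  | cast t ih =>
    intro i
    rw [logGradient_castSucc]
    exact add_nonneg (transpose_mulVec_one_nonneg hC i)
      (Finset.sum_nonneg fun j _ => mul_nonneg (transition_nonneg C lam hA t i j) (ih j))

/-- `transition` is positive on the support of `A`, so a vanishing derivative along `1` means that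
no observed state is reachable from `i` at or after time `t`. Then only row sums of `A` enter the
recursion. -/
lemma potential_eq_one (hA : ∀ t, RowStochastic (A t)) (hC : ∀ a i, 0 ≤ C a i)
    (lam' : Fin (N + 2) → Fin k → ℝ) (t : Fin (N + 2)) :
    ∀ i, logGradient A C lam t i 1 = 0 → potential A C lam' t i = 1 := by
  induction t using Fin.reverseInduction with
  | last =>
    intro i h
    rw [logGradient_last] at h
    rw [potential_last, scaling, transpose_mulVec_eq_zero hC h, Real.exp_zero]
  | cast t ih =>
    intro i h
    have h0 (j) : 0 ≤ transition A C lam t i j * logGradient A C lam t.succ j 1 :=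
      mul_nonneg (transition_nonneg C lam hA t i j) (logGradient_one_nonneg lam hA hC _ j)
    rw [logGradient_castSucc, Pi.one_apply, add_eq_zero_iff_of_nonneg (transpose_mulVec_one_nonneg hC i)
      (Finset.sum_nonneg fun j _ => h0 j), Finset.sum_eq_zero_iff_of_nonneg fun j _ => h0 j] at h
    rw [potential_castSucc, transpose_mulVec_eq_zero hC h.1, Real.exp_zero, one_mul,
      ← (hA t).sum_eq_one i]
    refine Finset.sum_congr rfl fun j _ => ?_
    rcases ((hA t).1 i j).eq_or_lt' with hj | hj
    · simp [hj]
    · rw [ih j ((mul_eq_zero.1 (h.2 j (Finset.mem_univ j))).resolve_left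
        (transition_pos C lam hA hj).ne'), mul_one]

end gradient

/-! ### First-order conditions at a dual maximizer -/

section kkt
variable {A : Fin (N + 1) → Matrix (Fin n) (Fin n) ℝ} {C : Matrix (Fin k) (Fin n) ℝ}
  {ρ lam : Fin (N + 2) → Fin k → ℝ}

lemma eventually_lt_of_hasDerivAt_neg {f : ℝ → ℝ} {f' x : ℝ} (hf : HasDerivAt f f' x)
    (h : f' < 0) : ∀ᶠ s in nhdsWithin x (Set.Ioi x), f s < f x := by
  have h1 := (hasDerivAt_iff_tendsto_slope.1 hf).eventually (gt_mem_nhds h)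
  have h2 := h1.filter_mono (nhdsWithin_mono x fun s (hs : x < s) => hs.ne')
  filter_upwards [h2, self_mem_nhdsWithin] with s hs hsx
  rw [slope_def_field, div_neg_iff] at hs
  have : x < s := hsx
  rcases hs with hs | hs <;> linarith [hs.1, hs.2]

variable (ρ) in
/-- The dual objective as a linear map. -/
def dualObjectiveMap : (Fin (N + 2) → Fin k → ℝ) →ₗ[ℝ] ℝ where
  toFun := dualObjective ρ
  map_add' x y := by simp [dualObjective, add_dotProduct, Finset.sum_add_distrib]
  map_smul' c x := by simp [dualObjective, smul_dotProduct, Finset.mul_sum]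

@[simp] lemma dualObjectiveMap_apply (d : Fin (N + 2) → Fin k → ℝ) :
    dualObjectiveMap ρ d = dualObjective ρ d := rfl

/-- A small step along `d` stays feasible: inactive constraints persist by continuity, active ones
strictly decrease, and those with zero derivative along `1` are constant by `potential_eq_one`. -/
lemma IsDualMaximizer.dualObjective_nonpos (h : IsDualMaximizer A C ρ lam)
    (hA : ∀ t, RowStochastic (A t)) (hC : ∀ a i, 0 ≤ C a i) (d : Fin (N + 2) → Fin k → ℝ)
    (hd : ∀ i, potential A C lam 0 i = 1 → 0 < logGradient A C lam 0 i 1 →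
      logGradient A C lam 0 i d < 0) : dualObjective ρ d ≤ 0 := by
  have hev : ∀ᶠ s : ℝ in nhdsWithin 0 (Set.Ioi 0), ∀ i, potential A C (lam + s • d) 0 i ≤ 1 := by
    rw [Filter.eventually_all]
    intro i
    have hder := hasDerivAt_potential C lam hA d 0 i
    have h0 : potential A C (lam + (0 : ℝ) • d) 0 i = potential A C lam 0 i := by simp
    rcases ((dualFeasible_iff_potential_le A C lam).1 h.1 i).lt_or_eq with hi | hi
    · have := hder.continuousAt.eventually_lt_const (h0.trans_lt hi)
      filter_upwards [this.filter_mono nhdsWithin_le_nhds] with s hs using hs.le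
    · rcases (logGradient_one_nonneg lam hA hC 0 i).eq_or_lt' with h1 | h1
      · exact Filter.Eventually.of_forall fun s => (potential_eq_one lam hA hC _ 0 i h1).le
      · have := eventually_lt_of_hasDerivAt_neg hder (by rw [hi, one_mul]; exact hd i hi h1)
        filter_upwards [this] with s hs
        rw [h0, hi] at hs
        exact hs.le
  obtain ⟨s, hs, hs0⟩ := (hev.and self_mem_nhdsWithin).exists
  have h1 := h.2 (lam + s • d) hs
  simp only [← dualObjectiveMap_apply, map_add, map_smul, smul_eq_mul] at h1 ⊢
  exact nonpos_of_mul_nonpos_right (by linarith) hs0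

/-- The Karush-Kuhn-Tucker conditions of the dual problem. -/
lemma IsDualMaximizer.exists_initial (h : IsDualMaximizer A C ρ lam)
    (hA : ∀ t, RowStochastic (A t)) (hC : ∀ a i, 0 ≤ C a i) :
    ∃ m : Fin n → ℝ, 0 ≤ m ∧ (∀ i, m i ≠ 0 → potential A C lam 0 i = 1) ∧
      ∀ d, dualObjective ρ d = ∑ i, m i * logGradient A C lam 0 i d := by
  classical
  -- Constant constraints are left out so that every remaining gradient is positive along `1`.
  let p : Fin n → Prop := fun i => potential A C lam 0 i = 1 ∧ 0 < logGradient A C lam 0 i 1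
  let f : Option {i // p i} → (Fin (N + 2) → Fin k → ℝ) →ₗ[ℝ] ℝ := fun o =>
    o.elim (-dualObjectiveMap ρ) fun i => logGradient A C lam 0 i
  obtain ⟨c, hc, hc0, hsum⟩ := exists_nonneg_combination_eq_zero f fun d => by
    by_contra! hd
    have h1 := hd none
    simp only [f, Option.elim_none, LinearMap.neg_apply, dualObjectiveMap_apply] at h1
    have := h.dualObjective_nonpos hA hC d fun i hi1 hi2 => hd (some ⟨i, hi1, hi2⟩)
    linarith
  simp only [Fintype.sum_option, f, Option.elim_none, Option.elim_some, LinearMap.neg_apply,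
    dualObjectiveMap_apply] at hsum
  -- Constraint qualification: if the objective had weight zero, testing with `d = 1` would make all
  -- weights vanish.
  have hτ : 0 < c none := by
    refine (hc none).lt_of_ne' fun h0 => hc0 ?_
    have h1 := hsum 1
    rw [h0, Pi.zero_apply, zero_mul, zero_add, Finset.sum_eq_zero_iff_of_nonneg
      fun i _ => mul_nonneg (hc (some i)) i.2.2.le] at h1
    ext o
    cases o with
    | none => exact h0
    | some i => exact (mul_eq_zero.1 (h1 i (Finset.mem_univ i))).resolve_right i.2.2.ne'
  refine ⟨fun i => if hi : p i then c (some ⟨i, hi⟩) / c none else 0, fun i => ?_, fun i hi => ?_,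
    fun d => ?_⟩
  · by_cases hi : p i
    · simpa [hi] using div_nonneg (hc (some ⟨i, hi⟩)) hτ.le
    · simp [hi]
  · by_contra hp
    exact hi (dif_neg fun h => hp h.1)
  · have h1 := hsum d
    have h2 : ∑ i : {i // p i}, c (some i) / c none * logGradient A C lam 0 i d =
        ∑ i, (if hi : p i then c (some ⟨i, hi⟩) / c none else 0) * logGradient A C lam 0 i d :=
      Fintype.sum_of_injective _ Subtype.val_injective _ _
        (fun i hi => by rw [dif_neg fun h => hi ⟨⟨i, h⟩, rfl⟩, zero_mul])
        fun i => by rw [dif_pos i.2]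
    rw [← h2]
    simp only [div_mul_eq_mul_div]
    rw [← Finset.sum_div, eq_div_iff hτ.ne']
    linarith

end kkt

/-! ### The optimal flow built from the KKT weights -/

section flow
variable (A : Fin (N + 1) → Matrix (Fin n) (Fin n) ℝ) (C : Matrix (Fin k) (Fin n) ℝ)
  (lam : Fin (N + 2) → Fin k → ℝ) (m : Fin n → ℝ)

/-- The marginals of the reweighted Markov chain started in `m`. -/
def marginal : Fin (N + 2) → Fin n → ℝ :=
  Fin.induction (motive := fun _ => Fin n → ℝ) m
    fun t μ j => ∑ i, μ i * transition A C lam t i j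

@[simp] lemma marginal_zero : marginal A C lam m 0 = m := rfl

lemma marginal_succ (t : Fin (N + 1)) (j : Fin n) :
    marginal A C lam m t.succ j =
      ∑ i, marginal A C lam m t.castSucc i * transition A C lam t i j := by
  simp [marginal]

/-- The flow of the reweighted Markov chain started in `m`. -/
def flow (t : Fin (N + 1)) : Matrix (Fin n) (Fin n) ℝ :=
  Matrix.of fun i j => marginal A C lam m t.castSucc i * transition A C lam t i j

lemma flow_apply (t : Fin (N + 1)) (i j : Fin n) :
    flow A C lam m t i j = marginal A C lam m t.castSucc i * transition A C lam t i j := rfl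

lemma flow_transpose_mulVec_one (t : Fin (N + 1)) :
    (flow A C lam m t)ᵀ *ᵥ 1 = marginal A C lam m t.succ := by
  ext j
  simp only [transpose_mulVec_one_apply, marginal_succ, flow_apply]

/-- The forward recursion for `marginal` and the backward one for `logGradient` are adjoint, so
their pairing telescopes in time, leaving the observation terms. -/
lemma sum_mul_logGradient (d : Fin (N + 2) → Fin k → ℝ) :
    ∑ i, m i * logGradient A C lam 0 i d = ∑ t, d t ⬝ᵥ (C *ᵥ marginal A C lam m t) := by
  set g : Fin (N + 2) → ℝ := fun t => ∑ i, marginal A C lam m t i * logGradient A C lam t i d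
    with hg
  have hobs (t : Fin (N + 2)) : d t ⬝ᵥ (C *ᵥ marginal A C lam m t) =
      ∑ i, marginal A C lam m t i * (Cᵀ *ᵥ d t) i := by
    rw [Matrix.dotProduct_mulVec, ← Matrix.mulVec_transpose, dotProduct_comm]
    rfl
  have hstep (t : Fin (N + 1)) :
      d t.castSucc ⬝ᵥ (C *ᵥ marginal A C lam m t.castSucc) = g t.castSucc - g t.succ := by
    have : g t.succ = ∑ i, marginal A C lam m t.castSucc i *
        ∑ j, transition A C lam t i j * logGradient A C lam t.succ j d := by
      simp only [hg, marginal_succ, Finset.sum_mul, Finset.mul_sum]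
      rw [Finset.sum_comm]
      simp only [mul_assoc]
    rw [hobs, this, ← Finset.sum_sub_distrib]
    refine Finset.sum_congr rfl fun i _ => ?_
    rw [logGradient_castSucc]
    ring
  have hlast : d (Fin.last (N + 1)) ⬝ᵥ (C *ᵥ marginal A C lam m (Fin.last (N + 1))) =
      g (Fin.last (N + 1)) := by
    rw [hobs]
    simp only [hg, logGradient_last]
  rw [Fin.sum_univ_castSucc, hlast]
  simp only [hstep, Finset.sum_sub_distrib]
  have h1 := Fin.sum_univ_castSucc g
  have h2 := Fin.sum_univ_succ g
  have h3 : g 0 = ∑ i, m i * logGradient A C lam 0 i d := by simp [hg]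
  linarith

variable {A m}

lemma flow_mulVec_one (hA : ∀ t, RowStochastic (A t)) (t : Fin (N + 1)) :
    flow A C lam m t *ᵥ 1 = marginal A C lam m t.castSucc := by
  ext i
  simp only [mulVec_one_apply, flow_apply]
  rw [← Finset.mul_sum, sum_transition C lam hA, mul_one]

lemma marginal_nonneg (hA : ∀ t, RowStochastic (A t)) (hm : 0 ≤ m) (t : Fin (N + 2)) :
    0 ≤ marginal A C lam m t := by
  induction t using Fin.induction with
  | zero => exact hm
  | succ t ih =>
    intro j
    rw [marginal_succ]
    exact Finset.sum_nonneg fun i _ => mul_nonneg (ih i) (transition_nonneg C lam hA t i j)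

lemma flow_admissible (hA : ∀ t, RowStochastic (A t)) (hm : 0 ≤ m) :
    Admissible A (flow A C lam m) := by
  refine fun t => ⟨fun i j => mul_nonneg (marginal_nonneg C lam hA hm _ i)
    (transition_nonneg C lam hA t i j), fun i j h => ?_⟩
  rw [prior_apply, flow_mulVec_one C lam hA] at h
  rw [flow_apply]
  rcases mul_eq_zero.1 h with h | h <;> simp [transition, h]

/-- Wherever there is mass, the flow equals its tilted prior and the tilted row sum is one; at time
`0` this is where `hact` enters, giving potential `1 = w_0`. -/
lemma flow_lagrangian (hA : ∀ t, RowStochastic (A t)) (hm : 0 ≤ m)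
    (hact : ∀ i, m i ≠ 0 → potential A C lam 0 i = 1) (ρ : Fin (N + 2) → Fin k → ℝ) :
    lagrangian A C ρ (flow A C lam m) lam (logPotential A C lam) = dualObjective ρ lam := by
  rw [lagrangian_eq_sum C lam _ hA (flow_admissible C lam hA hm), add_eq_left]
  refine Finset.sum_eq_zero fun t _ => Finset.sum_eq_zero fun i _ => ?_
  rw [flow_mulVec_one C lam hA]
  by_cases h0 : marginal A C lam m t.castSucc i = 0
  · simp [flow_apply, h0, klTerm_self]
  have hpot : Real.exp (multiplier C lam (logPotential A C lam) t.castSucc i) =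
      potential A C lam t.castSucc i := by
    induction t using Fin.cases with
    | zero => simpa using (hact i h0).symm
    | succ s => rw [← Fin.succ_castSucc, exp_multiplier_succ C lam hA]
  have hne := (potential_pos C lam hA t.castSucc i).ne'
  rw [sum_mul_exp_tilt C lam hA, hpot, div_self hne, sub_self, mul_zero, add_zero]
  refine Finset.sum_eq_zero fun j _ => ?_
  rw [exp_tilt, hpot, exp_multiplier_succ C lam hA]
  convert klTerm_self _ using 2
  rw [flow_apply, transition, scaling]
  field_simp

lemma flow_primalFeasible (hA : ∀ t, RowStochastic (A t)) (hm : 0 ≤ m)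
    {ρ : Fin (N + 2) → Fin k → ℝ}
    (hρ : ∀ d, dualObjective ρ d = ∑ i, m i * logGradient A C lam 0 i d) :
    PrimalFeasible A C ρ (flow A C lam m) := by
  have h (t : Fin (N + 2)) : C *ᵥ marginal A C lam m t = ρ t := by
    -- Testing the stationarity identity with the observation residual itself yields a vanishing sum
    -- of squares.
    have h1 := hρ fun t => ρ t - C *ᵥ marginal A C lam m t
    rw [sum_mul_logGradient, dualObjective, ← sub_eq_zero, ← Finset.sum_sub_distrib] at h1
    simp only [← dotProduct_sub] at h1
    rw [Finset.sum_eq_zero_iff_of_nonneg fun t _ => by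
      exact Finset.sum_nonneg fun a _ => mul_self_nonneg _] at h1
    exact (sub_eq_zero.1 (dotProduct_self_eq_zero.1 (h1 t (Finset.mem_univ t)))).symm
  refine ⟨flow_admissible C lam hA hm, fun t => ?_, ?_, fun s => ?_⟩
  · rw [flow_mulVec_one C lam hA, h]
  · rw [flow_transpose_mulVec_one, Fin.succ_last, h]
  · rw [flow_mulVec_one C lam hA, flow_transpose_mulVec_one, Fin.succ_castSucc]

end flow

/-! ### Strong duality and the form of the optima -/

section duality
variable {A : Fin (N + 1) → Matrix (Fin n) (Fin n) ℝ} {C : Matrix (Fin k) (Fin n) ℝ}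
  {ρ lam : Fin (N + 2) → Fin k → ℝ}

lemma IsDualMaximizer.isLeast (h : IsDualMaximizer A C ρ lam)
    (hA : ∀ t, RowStochastic (A t)) (hC : ∀ a i, 0 ≤ C a i) :
    IsLeast (primalObjective A '' {M | PrimalFeasible A C ρ M}) (dualObjective ρ lam) := by
  obtain ⟨m, hm, hact, hρ⟩ := h.exists_initial hA hC
  have hM := flow_primalFeasible C lam hA hm hρ
  refine ⟨⟨flow A C lam m, hM, ?_⟩, ?_⟩
  · rw [← hM.lagrangian_eq lam (logPotential A C lam), flow_lagrangian C lam hA hm hact]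
  · rintro _ ⟨M, hM, rfl⟩
    rw [← hM.lagrangian_eq lam (logPotential A C lam)]
    exact (h.1.substochastic hA).le_lagrangian hA hM.admissible

/-- The vectors `w` depend only on `lam`: they are the exponentiated multipliers with interior part
`logPotential`. Each optimum has Lagrangian equal to the dual objective, so it coincides with its
tilted prior. -/
lemma IsDualMaximizer.exists_scaling_form (h : IsDualMaximizer A C ρ lam)
    (hA : ∀ t, RowStochastic (A t)) (hC : ∀ a i, 0 ≤ C a i) :
    ∃ w : Fin (N + 2) → Fin n → ℝ, (∀ t i, 0 < w t i) ∧ w 0 = 1 ∧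
      w (Fin.last (N + 1)) = scaling C lam (Fin.last (N + 1)) ∧
      ∀ M, IsPrimalOptimal A C ρ M → ∀ t : Fin (N + 1),
        M t = Matrix.diagonal (M t *ᵥ 1)
          * Matrix.diagonal (scaling C lam t.castSucc / w t.castSucc)
          * A t * Matrix.diagonal (w t.succ) := by
  refine ⟨fun t i => Real.exp (multiplier C lam (logPotential A C lam) t i),
    fun t i => Real.exp_pos _, ?_, ?_, fun M hM t => ?_⟩
  · ext i; simp
  · ext i; simp [scaling]
  · obtain ⟨⟨M', hM', hval⟩, hlb⟩ := h.isLeast hA hC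
    have hopt : primalObjective A M = dualObjective ρ lam :=
      le_antisymm (hval ▸ hM.2 M' hM') (hlb ⟨M, hM.1, rfl⟩)
    have heq := (h.1.substochastic hA).eq_of_lagrangian_eq (ρ := ρ) hA hM.1.admissible
      ((hM.1.lagrangian_eq _ _).trans hopt) t
    ext i j
    rw [Matrix.mul_diagonal, Matrix.diagonal_mul_diagonal, Matrix.diagonal_mul, heq i j, exp_tilt,
      Pi.div_apply]
    ring

lemma iSup_dualFunction_eq (h : DualFeasible A C lam) (hA : ∀ t, RowStochastic (A t)) :
    ⨆ ν, dualFunction A C ρ lam ν = dualObjective ρ lam :=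
  le_antisymm (iSup_le fun _ => dualFunction_le)
    (le_iSup_of_le (logPotential A C lam) ((h.substochastic hA).dualFunction_eq hA).ge)

lemma iSup_dualFunction_eq_bot (h : ¬ DualFeasible A C lam) (hA : ∀ t, RowStochastic (A t)) :
    ⨆ ν, dualFunction A C ρ lam ν = ⊥ :=
  iSup_eq_bot.2 fun _ => dualFunction_eq_bot hA fun hν => h (hν.dualFeasible hA)

lemma obsMatrix_nonneg (π : Fin k ↪ Fin n) (a : Fin k) (i : Fin n) : 0 ≤ obsMatrix π a i := by
  rw [obsMatrix, Matrix.of_apply, Pi.single_apply]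
  split_ifs <;> simp

end duality

end PartialSB

end

theorem mainTheorem1 {n k N : ℕ}
    (A : Fin (N + 1) → Matrix (Fin n) (Fin n) ℝ) (hA : ∀ t, PartialSB.RowStochastic (A t))
    (π : Fin k ↪ Fin n) (ρ : Fin (N + 2) → Fin k → ℝ)
    (hreg : PartialSB.Regular A (PartialSB.obsMatrix π) ρ) :
    -- maximizing the Lagrangian dual function over the matching multipliers gives the dual problem
    (∀ lam : Fin (N + 2) → Fin k → ℝ,
      (PartialSB.DualFeasible A (PartialSB.obsMatrix π) lam →
        (⨆ ν : Fin N → Fin n → ℝ, PartialSB.dualFunction A (PartialSB.obsMatrix π) ρ lam ν)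
          = (PartialSB.dualObjective ρ lam : EReal)) ∧
      (¬ PartialSB.DualFeasible A (PartialSB.obsMatrix π) lam →
        (⨆ ν : Fin N → Fin n → ℝ, PartialSB.dualFunction A (PartialSB.obsMatrix π) ρ lam ν)
          = ⊥)) ∧
    -- the dual maximum is attained
    (∃ lam, PartialSB.IsDualMaximizer A (PartialSB.obsMatrix π) ρ lam) ∧
    (∀ lam, PartialSB.IsDualMaximizer A (PartialSB.obsMatrix π) ρ lam →
      -- there is no duality gap
      IsGLB (PartialSB.primalObjective A ''
          {M | PartialSB.PrimalFeasible A (PartialSB.obsMatrix π) ρ M})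
        (PartialSB.dualObjective ρ lam) ∧
      -- the scaling form of all primal optimal solutions
      ∃ w : Fin (N + 2) → Fin n → ℝ,
        (∀ t i, 0 < w t i) ∧ w 0 = 1 ∧
        w (Fin.last (N + 1))
          = PartialSB.scaling (PartialSB.obsMatrix π) lam (Fin.last (N + 1)) ∧
        ∀ M, PartialSB.IsPrimalOptimal A (PartialSB.obsMatrix π) ρ M →
          ∀ t : Fin (N + 1),
            M t = Matrix.diagonal (M t *ᵥ 1)
              * Matrix.diagonal
                  (PartialSB.scaling (PartialSB.obsMatrix π) lam t.castSucc / w t.castSucc)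
              * A t * Matrix.diagonal (w t.succ)) := by
  
  have hC := PartialSB.obsMatrix_nonneg π
  exact ⟨fun lam => ⟨fun h => PartialSB.iSup_dualFunction_eq h hA,
      fun h => PartialSB.iSup_dualFunction_eq_bot h hA⟩,
    PartialSB.exists_isDualMaximizer hA hreg,
    fun lam h => ⟨(h.isLeast hA hC).isGLB, h.exists_scaling_form hA hC⟩⟩
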